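/- Let $k\ge 0$ be an integer, let $m=2k+1$, and let $\beta=\mathcal{G}(m)$, where the generalized golden ratio is $\mathcal{G}(m)=\frac{k+1+\sqrt{k^{2}+6k+5}}{2}$ for odd $m=2k+1$. A $\beta$-expansion of a real number $x$ is a sequence $(\varepsilon_i)_{i\ge 1}\in\{0,1,\dots,m\}^{\infty}$ with $x=\sum_{i=1}^{\infty}\varepsilon_i\beta^{-i}$. Then $\frac{m}{\beta-1}=\beta-k$. Let $$\mathcal{S}=\Big\{\frac{p\beta+q}{(k+1)^{n}}\in\Big(0,\frac{m}{\beta-1}\Big): n,p,q\in\mathbb{Z}\Big\}.$$ Every element of $\mathcal{S}$ has countably many $\beta$-expansions, namely exactly $\aleph_0$ of them, while every other element of $(0,\beta-k)$ has uncountably many $\beta$-expansions, namely exactly $2^{\aleph_0}$ of them. -/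

import Mathlib

/-- The set of `β`-expansions of `x` with digits `0, 1, …, m`: all digit sequences
`(ε₁, ε₂, …)` with `x = ∑_{i ≥ 1} ε_i / β ^ i`. The entry `ε i` is the digit `ε_{i+1}`. -/
def betaExpansions (β : ℝ) (m : ℕ) (x : ℝ) : Set (ℕ → Fin (m + 1)) :=
  {ε | HasSum (fun i : ℕ => ((ε i : ℕ) : ℝ) / β ^ (i + 1)) x}

/-- The generalized golden ratio `𝒢(m)`: it is `k + 1` if `m = 2k`, and
`(k + 1 + √(k² + 6k + 5)) / 2` if `m = 2k + 1`. Here `m / 2 : ℕ` is `k` in both cases. -/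
noncomputable def generalizedGoldenRatio (m : ℕ) : ℝ :=
  let k : ℝ := ((m / 2 : ℕ) : ℝ)
  if Even m then k + 1 else (k + 1 + Real.sqrt (k ^ 2 + 6 * k + 5)) / 2

/-- The points of the form `(p β + q) / (k + 1) ^ n`, with `n, p, q ∈ ℤ`, that lie in the open
interval `(0, m / (β - 1))`, where `m = 2k + 1` and `β = 𝒢(m)`. -/
def countableExpansionPoints (k : ℕ) : Set ℝ :=
  {x | x ∈ Set.Ioo (0 : ℝ)
        (((2 * k + 1 : ℕ) : ℝ) / (generalizedGoldenRatio (2 * k + 1) - 1)) ∧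
      ∃ n p q : ℤ,
        x = ((p : ℝ) * generalizedGoldenRatio (2 * k + 1) + (q : ℝ)) / ((k : ℝ) + 1) ^ n}

/-! The tails of an expansion of `x` are the expansions of its remainders
`r (n + 1) = β * r n - ε n`. Put `L = m / (β - 1)`. When `β ^ 2 ≤ (k + 1) * (β + 1)`,
the two central digits `k` and `k + 1` are both admissible on `[L - 1, 1]`,
and every point of `(0, L)` either has two admissible digits after some initial zeros
or can be moved into that interval (up to the reflection `x ↦ L - x`); so every point
of `(0, L)` has at least two expansions. An expansion with all remainders in `(0, L)` is therefore
an accumulation point of the closed set of expansions of `x`, which is thus infinite, and perfect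
if no expansion of `x` has `0` or `L` as a remainder.

For the generalized golden ratio equality holds, and `L = β - k` lies in `ℤ[β]`. The points of `𝒮`
are those having a remainder in `ℤ[β]`, so outside `𝒮` no remainder is `0` or `L`. From a point
of `ℤ[β]` on, the remainders are `b (n + 1) + θ * b n` with `θ = β - k - 1 ∈ (0, 1)` and an integer
sequence `b`, and `0 ≤ r n ≤ L = 1 + θ` forces `|b (n + 1) - b n|` to decrease strictly unless
`b (n + 2) = b n`. So the digits are eventually 2-periodic, which leaves only countably many
expansions.
-/

open Filter Set Topology

section GeneralBase

variable {m : ℕ} {β x : ℝ} {ε : ℕ → Fin (m + 1)}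

/-- The `n`-th remainder of `x` along the digit sequence `ε` in base `β`: the number
`β ^ n x - ∑_{i < n} ε_i β ^ (n - 1 - i)` that the digits from position `n` on must expand. -/
def digitRemainder (β : ℝ) (ε : ℕ → Fin (m + 1)) (x : ℝ) : ℕ → ℝ
  | 0 => x
  | n + 1 => β * digitRemainder β ε x n - (ε n : ℕ)

theorem digitRemainder_congr {δ : ℕ → Fin (m + 1)} {n : ℕ} (h : ∀ i < n, δ i = ε i) :
    digitRemainder β δ x n = digitRemainder β ε x n := by
  induction n with
  | zero => rfl
  | succ n ih =>
    rw [digitRemainder, digitRemainder, ih fun i hi => h i (hi.trans n.lt_succ_self),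
      h n n.lt_succ_self]

theorem digitRemainder_zero (β x : ℝ) (n : ℕ) :
    digitRemainder β (0 : ℕ → Fin (m + 1)) x n = β ^ n * x := by
  induction n with
  | zero => simp [digitRemainder]
  | succ n ih => simp [digitRemainder, ih, pow_succ', mul_assoc]

theorem sum_range_digits (hβ : β ≠ 0) (ε : ℕ → Fin (m + 1)) (x : ℝ) (n : ℕ) :
    ∑ i ∈ Finset.range n, ((ε i : ℕ) : ℝ) / β ^ (i + 1) = x - digitRemainder β ε x n / β ^ n := by
  induction n with
  | zero => simp [digitRemainder]
  | succ n ih =>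
    rw [Finset.sum_range_succ, ih, digitRemainder]
    field_simp
    ring

theorem shift_mem_betaExpansions_iff (hβ : β ≠ 0) (n : ℕ) :
    (fun i => ε (i + n)) ∈ betaExpansions β m (digitRemainder β ε x n) ↔
      ε ∈ betaExpansions β m x := by
  have hscale := hasSum_div_const_iff (L := .unconditional ℕ) (pow_ne_zero n hβ)
    (f := fun i => ((ε (i + n) : ℕ) : ℝ) / β ^ (i + 1)) (a₁ := digitRemainder β ε x n)
  have hsplit := hasSum_nat_add_iff' (f := fun i => ((ε i : ℕ) : ℝ) / β ^ (i + 1)) (g := x) n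
  rw [sum_range_digits hβ, sub_sub_cancel] at hsplit
  simp only [div_div, ← pow_add, add_right_comm _ 1 n] at hscale
  exact hscale.symm.trans hsplit

theorem exists_mem_betaExpansions_of_mem_digitRemainder (hβ : β ≠ 0) {n : ℕ}
    {η : ℕ → Fin (m + 1)} (hη : η ∈ betaExpansions β m (digitRemainder β ε x n)) :
    ∃ δ ∈ betaExpansions β m x, (∀ i < n, δ i = ε i) ∧ (fun i => δ (i + n)) = η := by
  let δ : ℕ → Fin (m + 1) := fun i => if i < n then ε i else η (i - n)
  have hagree : ∀ i < n, δ i = ε i := fun i hi => if_pos hi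
  have hshift : (fun i => δ (i + n)) = η := by
    funext i
    simp [δ]
  refine ⟨δ, (shift_mem_betaExpansions_iff hβ n).1 ?_, hagree, hshift⟩
  rwa [hshift, digitRemainder_congr hagree]

theorem nontrivial_betaExpansions_of_digitRemainder (hβ : β ≠ 0) {n : ℕ}
    (h : (betaExpansions β m (digitRemainder β ε x n)).Nontrivial) :
    (betaExpansions β m x).Nontrivial := by
  obtain ⟨η, hη, η', hη', hne⟩ := h
  obtain ⟨δ, hδ, -, rfl⟩ := exists_mem_betaExpansions_of_mem_digitRemainder hβ hη
  obtain ⟨δ', hδ', -, rfl⟩ := exists_mem_betaExpansions_of_mem_digitRemainder hβ hη'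
  exact ⟨δ, hδ, δ', hδ', fun e => hne (by rw [e])⟩

theorem hasSum_const_div_pow_succ (hβ : 1 < β) (c : ℝ) :
    HasSum (fun i : ℕ => c / β ^ (i + 1)) (c / (β - 1)) := by
  have hβ1 : β - 1 ≠ 0 := by linarith
  have hgeom := (hasSum_geometric_of_lt_one (r := β⁻¹) (by positivity)
    (inv_lt_one_of_one_lt₀ hβ)).mul_left (c / β)
  have hlimit : c / β * (1 - β⁻¹)⁻¹ = c / (β - 1) := by
    rw [show 1 - β⁻¹ = (β - 1) / β by field_simp]
    field_simp
  rw [hlimit] at hgeom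
  refine hgeom.congr_fun fun i => ?_
  rw [inv_pow, pow_succ]
  field_simp

theorem mem_Icc_of_mem_betaExpansions (hβ : 1 < β) (hε : ε ∈ betaExpansions β m x) :
    x ∈ Icc 0 (m / (β - 1)) := by
  have := one_pos.trans hβ
  refine ⟨hε.nonneg fun i => by positivity,
    hasSum_le (fun i => ?_) hε (hasSum_const_div_pow_succ hβ m)⟩
  have hdigit : ((ε i : ℕ) : ℝ) ≤ m := by exact_mod_cast (ε i).is_le
  gcongr

theorem digitRemainder_mem_Icc (hβ : 1 < β) (hε : ε ∈ betaExpansions β m x) (n : ℕ) :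
    digitRemainder β ε x n ∈ Icc 0 (m / (β - 1)) :=
  mem_Icc_of_mem_betaExpansions hβ
    ((shift_mem_betaExpansions_iff (one_pos.trans hβ).ne' n).2 hε)

theorem rev_mem_betaExpansions (hβ : 1 < β) (hε : ε ∈ betaExpansions β m x) :
    (fun i => (ε i).rev) ∈ betaExpansions β m (m / (β - 1) - x) := by
  refine ((hasSum_const_div_pow_succ hβ m).sub hε).congr_fun fun i => ?_
  rw [Fin.val_rev, Nat.add_sub_add_right, Nat.cast_sub (ε i).is_le, sub_div]

theorem nontrivial_betaExpansions_of_reflect (hβ : 1 < β)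
    (h : (betaExpansions β m (m / (β - 1) - x)).Nontrivial) :
    (betaExpansions β m x).Nontrivial := by
  obtain ⟨η, hη, η', hη', hne⟩ := h
  refine ⟨_, ?_, _, ?_, fun e => hne (funext fun i => Fin.rev_injective (congrFun e i))⟩ <;>
    rw [← sub_sub_cancel (m / (β - 1)) x]
  exacts [rev_mem_betaExpansions hβ hη, rev_mem_betaExpansions hβ hη']

theorem mem_betaExpansions_of_abs_digitRemainder_le (hβ : 1 < β) {C : ℝ}
    (h : ∀ n, |digitRemainder β ε x n| ≤ C) : ε ∈ betaExpansions β m x := by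
  have hβ0 : 0 < β := one_pos.trans hβ
  have hzero : Tendsto (fun n => digitRemainder β ε x n / β ^ n) atTop (𝓝 0) :=
    bdd_le_mul_tendsto_zero' C (.of_forall h)
      (tendsto_pow_atTop_atTop_of_one_lt hβ).inv_tendsto_atTop
  rw [betaExpansions, mem_ofPred_eq, hasSum_iff_tendsto_nat_of_nonneg fun i => by positivity]
  simpa only [sum_range_digits hβ0.ne' ε x, sub_zero] using hzero.const_sub x

theorem exists_mem_betaExpansions_of_invariant (hβ : 1 < β) {I : Set ℝ}
    (hI : Bornology.IsBounded I) (hstep : ∀ y ∈ I, ∃ j : Fin (m + 1), β * y - (j : ℕ) ∈ I)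
    (hx : x ∈ I) : ∃ ε ∈ betaExpansions β m x, ∀ n, digitRemainder β ε x n ∈ I := by
  choose d hd using fun y : I => hstep y y.2
  let orbit : ℕ → I := fun n => (fun y : I => ⟨β * y - (d y : ℕ), hd y⟩)^[n] ⟨x, hx⟩
  have horbit : ∀ n, digitRemainder β (fun n => d (orbit n)) x n = orbit n := by
    intro n
    induction n with
    | zero => rfl
    | succ n ih => simp only [digitRemainder, ih, orbit, Function.iterate_succ_apply']
  obtain ⟨C, hC⟩ := isBounded_iff_forall_norm_le.1 hI
  refine ⟨fun n => d (orbit n),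
    mem_betaExpansions_of_abs_digitRemainder_le hβ (C := C) fun n => ?_, fun n => ?_⟩
  · rw [horbit]
    exact hC _ (orbit n).2
  · rw [horbit]
    exact (orbit n).2

theorem mul_div_sub_one (hβ : 1 < β) (c : ℝ) : β * (c / (β - 1)) = c / (β - 1) + c := by
  have hβ1 : β - 1 ≠ 0 := by linarith
  field_simp
  ring

theorem exists_digit_mem_Icc (hβ : 1 < β) (hβm : β ≤ m + 1) {y : ℝ}
    (hy : y ∈ Icc 0 (m / (β - 1))) :
    ∃ j : Fin (m + 1), β * y - (j : ℕ) ∈ Icc 0 (m / (β - 1)) := by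
  have hL : 1 ≤ m / (β - 1) := by
    rw [le_div_iff₀ (by linarith)]
    linarith
  have hβy : 0 ≤ β * y := mul_nonneg (one_pos.trans hβ).le hy.1
  rcases le_or_gt (m : ℝ) (β * y) with hm | hm
  · refine ⟨Fin.last m, by simpa using hm, ?_⟩
    have hmul := mul_le_mul_of_nonneg_left hy.2 (one_pos.trans hβ).le
    rw [mul_div_sub_one hβ] at hmul
    simpa using hmul
  · have hfloor : ⌊β * y⌋₊ < m := (Nat.floor_lt hβy).2 hm
    exact ⟨⟨⌊β * y⌋₊, by lia⟩, sub_nonneg.2 (Nat.floor_le hβy), by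
      linarith [Nat.lt_floor_add_one (β * y)]⟩

theorem exists_digit_mem_Ioo (hβ : 1 < β) (hβm : β < m + 1) {y : ℝ}
    (hy : y ∈ Ioo 0 (m / (β - 1))) :
    ∃ j : Fin (m + 1), β * y - (j : ℕ) ∈ Ioo 0 (m / (β - 1)) := by
  have hL : 1 < m / (β - 1) := by
    rw [lt_div_iff₀ (by linarith)]
    linarith
  have hβy : 0 < β * y := mul_pos (one_pos.trans hβ) hy.1
  rcases lt_or_ge (m : ℝ) (β * y) with hm | hm
  · refine ⟨Fin.last m, by simpa using hm, ?_⟩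
    have hmul := mul_lt_mul_of_pos_left hy.2 (one_pos.trans hβ)
    rw [mul_div_sub_one hβ] at hmul
    rwa [Fin.val_last, sub_lt_iff_lt_add]
  · obtain ⟨j, hj⟩ : ∃ j, ⌈β * y⌉₊ = j + 1 := Nat.exists_eq_succ_of_ne_zero (Nat.ceil_pos.2 hβy).ne'
    have hjm := Nat.ceil_le.2 hm
    have hlower := Nat.le_ceil (β * y)
    have hupper := Nat.ceil_lt_add_one hβy.le
    rw [hj] at hjm hlower hupper
    push_cast at hlower hupper
    exact ⟨⟨j, by lia⟩, by simp only; linarith, by simp only; linarith⟩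

theorem betaExpansions_nonempty (hβ : 1 < β) (hβm : β ≤ m + 1)
    (hx : x ∈ Icc 0 (m / (β - 1))) : (betaExpansions β m x).Nonempty :=
  let ⟨ε, hε, _⟩ := exists_mem_betaExpansions_of_invariant hβ (Metric.isBounded_Icc _ _)
    (fun _ => exists_digit_mem_Icc hβ hβm) hx
  ⟨ε, hε⟩

theorem nontrivial_betaExpansions_of_two_digits (hβ : 1 < β) (hβm : β ≤ m + 1) {i j : ℕ}
    (hi : i < m + 1) (hj : j < m + 1) (hij : i ≠ j) (hxi : β * x - i ∈ Icc 0 (m / (β - 1)))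
    (hxj : β * x - j ∈ Icc 0 (m / (β - 1))) : (betaExpansions β m x).Nontrivial := by
  have hcons : ∀ d : Fin (m + 1), β * x - (d : ℕ) ∈ Icc 0 (m / (β - 1)) →
      ∃ δ ∈ betaExpansions β m x, δ 0 = d := fun d hd => by
    obtain ⟨η, hη⟩ := betaExpansions_nonempty hβ hβm hd
    obtain ⟨δ, hδ, hδ0, -⟩ := exists_mem_betaExpansions_of_mem_digitRemainder
      (ε := fun _ => d) (n := 1) (one_pos.trans hβ).ne' hη
    exact ⟨δ, hδ, hδ0 0 one_pos⟩
  obtain ⟨δ, hδ, hδ0⟩ := hcons ⟨i, hi⟩ hxi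
  obtain ⟨δ', hδ', hδ0'⟩ := hcons ⟨j, hj⟩ hxj
  refine ⟨δ, hδ, δ', hδ', fun e => hij ?_⟩
  rw [e, hδ0'] at hδ0
  exact (congrArg Fin.val hδ0).symm

theorem isClosed_betaExpansions (hβ : 1 < β) (m : ℕ) (x : ℝ) :
    IsClosed (betaExpansions β m x) := by
  have := one_pos.trans hβ
  have hsum := (hasSum_const_div_pow_succ hβ m).summable
  have hle (i : ℕ) (ε : ℕ → Fin (m + 1)) : ‖((ε i : ℕ) : ℝ) / β ^ (i + 1)‖ ≤ m / β ^ (i + 1) := by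
    have hdigit : ((ε i : ℕ) : ℝ) ≤ m := by exact_mod_cast (ε i).is_le
    rw [Real.norm_of_nonneg (by positivity)]
    gcongr
  have hcont : Continuous fun ε : ℕ → Fin (m + 1) => ∑' i, ((ε i : ℕ) : ℝ) / β ^ (i + 1) :=
    continuous_tsum (fun i => ((continuous_of_discreteTopology
      (f := fun j : Fin (m + 1) => ((j : ℕ) : ℝ))).comp (continuous_apply i)).div_const _) hsum hle
  have hpreimage : betaExpansions β m x =
      (fun ε : ℕ → Fin (m + 1) => ∑' i, ((ε i : ℕ) : ℝ) / β ^ (i + 1)) ⁻¹' {x} :=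
    ext fun ε => (hsum.of_norm_bounded fun i => hle i ε).hasSum_iff
  exact hpreimage ▸ isClosed_singleton.preimage hcont

theorem accPt_betaExpansions (hβ : β ≠ 0)
    (h : ∀ n, (betaExpansions β m (digitRemainder β ε x n)).Nontrivial) :
    AccPt ε (𝓟 (betaExpansions β m x)) := by
  have hbranch (n : ℕ) : ∃ δ ∈ betaExpansions β m x, (∀ i < n, δ i = ε i) ∧ δ ≠ ε := by
    obtain ⟨η, hη, hne⟩ := (h n).exists_ne fun i => ε (i + n)
    obtain ⟨δ, hδ, hagree, rfl⟩ := exists_mem_betaExpansions_of_mem_digitRemainder hβ hη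
    exact ⟨δ, hδ, hagree, fun e => hne (by rw [e])⟩
  choose δ hδ hagree hne using hbranch
  have hlim : Tendsto δ atTop (𝓝 ε) := tendsto_pi_nhds.2 fun i =>
    tendsto_const_nhds.congr' ((eventually_gt_atTop i).mono fun n hn => (hagree n i hn).symm)
  exact accPt_iff_frequently.2 (hlim.frequently (.of_forall fun n => ⟨hne n, hδ n⟩))

theorem continuum_le_mk_of_perfect {α : Type*} [TopologicalSpace α]
    [TopologicalSpace.IsCompletelyMetrizableSpace α] {C : Set α} (hC : Perfect C)
    (hne : C.Nonempty) : Cardinal.continuum ≤ Cardinal.mk C := by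
  let := TopologicalSpace.upgradeIsCompletelyMetrizable α
  obtain ⟨f, hfC, -, hf⟩ := hC.exists_nat_bool_injection hne
  simpa using Cardinal.lift_mk_le_lift_mk_of_injective (hf.codRestrict fun b => hfC ⟨b, rfl⟩)

theorem mk_betaExpansions_eq_continuum (hβ : 1 < β) (hne : (betaExpansions β m x).Nonempty)
    (h : ∀ ε ∈ betaExpansions β m x, ∀ n,
      (betaExpansions β m (digitRemainder β ε x n)).Nontrivial) :
    Cardinal.mk (betaExpansions β m x) = Cardinal.continuum := by
  refine le_antisymm ((Cardinal.mk_set_le _).trans ?_) (continuum_le_mk_of_perfect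
    ⟨isClosed_betaExpansions hβ m x,
      fun ε hε => accPt_betaExpansions (one_pos.trans hβ).ne' (h ε hε)⟩ hne)
  have hpow := Cardinal.power_le_power_right (c := Cardinal.aleph0)
    (Cardinal.nat_lt_continuum (m + 1)).le
  rw [Cardinal.continuum_power_aleph0] at hpow
  simpa using hpow

end GeneralBase

section SmallBase

variable {k : ℕ} {β x : ℝ}

theorem lt_add_two_of_sq_le (hβ : 1 < β) (h : β ^ 2 ≤ (k + 1) * (β + 1)) : β < k + 2 := by
  nlinarith [k.cast_nonneg (α := ℝ)]

theorem lt_two_mul_add_two_of_sq_le (hβ : 1 < β) (h : β ^ 2 ≤ (k + 1) * (β + 1)) :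
    β < (2 * k + 1 : ℕ) + 1 := by
  push_cast
  linarith [lt_add_two_of_sq_le hβ h, k.cast_nonneg (α := ℝ)]

theorem le_add_div_of_sq_le (hβ : 1 < β) (h : β ^ 2 ≤ (k + 1) * (β + 1)) :
    β ≤ k + (2 * k + 1 : ℕ) / (β - 1) := by
  rw [← sub_le_iff_le_add', le_div_iff₀ (by linarith)]
  push_cast
  linarith

theorem nontrivial_betaExpansions_of_mem_Icc (hβ : 1 < β) (h : β ^ 2 ≤ (k + 1) * (β + 1))
    (hx : x ∈ Icc ((2 * k + 1 : ℕ) / (β - 1) - 1) 1) :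
    (betaExpansions β (2 * k + 1) x).Nontrivial := by
  have hβ0 := one_pos.trans hβ
  have hβL := mul_div_sub_one hβ (2 * k + 1 : ℕ)
  have hle := le_add_div_of_sq_le hβ h
  have hlower := mul_le_mul_of_nonneg_left hx.1 hβ0.le
  have hupper := mul_le_mul_of_nonneg_left hx.2 hβ0.le
  rw [mul_sub, hβL] at hlower
  refine nontrivial_betaExpansions_of_two_digits (i := k) (j := k + 1) hβ
    (lt_two_mul_add_two_of_sq_le hβ h).le (by lia) (by lia) (by lia) ?_ ?_ <;>
    push_cast at * <;> constructor <;> linarith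

theorem nontrivial_betaExpansions_of_mul_mem_Icc (hβ : 1 < β) (h : β ^ 2 ≤ (k + 1) * (β + 1))
    (hx : β * x ∈ Icc 1 (2 * k + (2 * k + 1 : ℕ) / (β - 1))) :
    (betaExpansions β (2 * k + 1) x).Nontrivial := by
  set L : ℝ := (2 * k + 1 : ℕ) / (β - 1) with hL
  have hβm := lt_two_mul_add_two_of_sq_le hβ h
  obtain ⟨j, hj, hjx, hxj⟩ : ∃ j ≤ 2 * k, j + 1 ≤ β * x ∧ (β * x < j + 2 ∨ β * x ≤ j + L) := by
    rcases lt_or_ge (β * x) (2 * k + 2) with hlt | hge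
    · obtain ⟨j, hj⟩ : ∃ j, ⌊β * x⌋₊ = j + 1 :=
        Nat.exists_eq_succ_of_ne_zero (Nat.floor_pos.2 hx.1).ne'
      have hfloor := Nat.floor_le (zero_le_one.trans hx.1)
      have hlt_floor := Nat.lt_floor_add_one (β * x)
      have hj_lt : ⌊β * x⌋₊ < 2 * k + 2 :=
        (Nat.floor_lt (zero_le_one.trans hx.1)).2 (by exact_mod_cast hlt)
      rw [hj] at hfloor hlt_floor hj_lt
      push_cast at hfloor hlt_floor
      exact ⟨j, by lia, hfloor, .inl (by linarith)⟩
    · exact ⟨2 * k, le_rfl, by push_cast; linarith, .inr (by simpa using hx.2)⟩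
  rcases le_or_gt (β * x) (j + L) with hle | hgt
  · have : 1 ≤ L := by
      rw [hL, le_div_iff₀ (by linarith)]
      linarith
    refine nontrivial_betaExpansions_of_two_digits (i := j) (j := j + 1) hβ hβm.le (by lia)
      (by lia) (by lia) ?_ ?_ <;> rw [← hL] <;> push_cast <;> constructor <;> linarith
  -- If the digit `j` is too small, the digit `j + 1` leads into the central interval.
  · have hcentral := nontrivial_betaExpansions_of_mem_Icc (x := β * x - (j + 1 : ℕ)) hβ h (by
      rw [← hL]
      push_cast
      constructor <;> linarith [hxj.resolve_right hgt.not_ge])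
    exact nontrivial_betaExpansions_of_digitRemainder (one_pos.trans hβ).ne' (n := 1)
      (ε := fun _ => ⟨j + 1, by lia⟩) hcentral

theorem nontrivial_betaExpansions_of_le_one (hβ : 1 < β) (h : β ^ 2 ≤ (k + 1) * (β + 1))
    (hx0 : 0 < x) (hx1 : x ≤ 1) : (betaExpansions β (2 * k + 1) x).Nontrivial := by
  have hβ0 := one_pos.trans hβ
  obtain ⟨n, hle, hlt⟩ := exists_nat_pow_near (one_le_inv_iff₀.2 ⟨hx0, hx1⟩) hβ
  have hupper : β ^ n * x ≤ 1 := (le_mul_inv_iff₀ hx0).1 (by rwa [one_mul])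
  have hlower : 1 ≤ β * (β ^ n * x) := by
    rw [← mul_assoc, ← pow_succ']
    exact (inv_le_iff_one_le_mul₀ hx0).1 hlt.le
  refine nontrivial_betaExpansions_of_digitRemainder hβ0.ne' (ε := 0) (n := n) ?_
  rw [digitRemainder_zero]
  exact nontrivial_betaExpansions_of_mul_mem_Icc hβ h ⟨hlower, by
    linarith [mul_le_of_le_one_right hβ0.le hupper, le_add_div_of_sq_le hβ h,
      k.cast_nonneg (α := ℝ)]⟩

theorem nontrivial_betaExpansions_of_mem_Ioo (hβ : 1 < β) (h : β ^ 2 ≤ (k + 1) * (β + 1))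
    (hx : x ∈ Ioo 0 ((2 * k + 1 : ℕ) / (β - 1))) :
    (betaExpansions β (2 * k + 1) x).Nontrivial := by
  rcases le_total x 1 with hx1 | hx1
  · exact nontrivial_betaExpansions_of_le_one hβ h hx.1 hx1
  rcases le_total ((2 * k + 1 : ℕ) / (β - 1) - x) 1 with hx2 | hx2
  · exact nontrivial_betaExpansions_of_reflect hβ
      (nontrivial_betaExpansions_of_le_one hβ h (sub_pos.2 hx.2) hx2)
  · have hβL := mul_div_sub_one hβ (2 * k + 1 : ℕ)
    have hmul := mul_le_mul_of_nonneg_left (le_sub_comm.1 hx2) (one_pos.trans hβ).le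
    rw [mul_sub, hβL] at hmul
    push_cast at hmul
    refine nontrivial_betaExpansions_of_mul_mem_Icc hβ h ⟨by nlinarith, ?_⟩
    push_cast
    linarith

theorem infinite_betaExpansions_of_mem_Ioo (hβ : 1 < β) (h : β ^ 2 ≤ (k + 1) * (β + 1))
    (hx : x ∈ Ioo 0 ((2 * k + 1 : ℕ) / (β - 1))) :
    (betaExpansions β (2 * k + 1) x).Infinite := by
  obtain ⟨ε, -, hε⟩ := exists_mem_betaExpansions_of_invariant hβ (Metric.isBounded_Ioo _ _)
    (fun _ => exists_digit_mem_Ioo hβ (lt_two_mul_add_two_of_sq_le hβ h)) hx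
  exact .of_accPt (accPt_betaExpansions (one_pos.trans hβ).ne' fun n =>
    nontrivial_betaExpansions_of_mem_Ioo hβ h (hε n))

end SmallBase

theorem countable_setOf_eventually_periodic {α : Type*} [Countable α] {p : ℕ} (hp : 0 < p) :
    {f : ℕ → α | ∀ᶠ n in atTop, f (n + p) = f n}.Countable := by
  have hunion : {f : ℕ → α | ∀ᶠ n in atTop, f (n + p) = f n} =
      ⋃ N, {f : ℕ → α | ∀ n ≥ N, f (n + p) = f n} := by
    ext f
    simp [eventually_atTop]
  rw [hunion]
  refine countable_iUnion fun N => MapsTo.countable_of_injOn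
    (f := fun f (i : Fin (N + p)) => f i) (mapsTo_univ _ _) (fun f hf g hg hfg => ?_)
    (to_countable univ)
  funext n
  induction n using Nat.strong_induction_on with
  | _ n ih =>
    rcases lt_or_ge n (N + p) with hn | hn
    · exact congrFun hfg ⟨n, hn⟩
    · obtain ⟨l, rfl⟩ := Nat.exists_eq_add_of_le' (le_of_add_le_right hn)
      rw [hf l (by lia), hg l (by lia), ih l (by lia)]

section IntegerCoordinates

variable {θ : ℝ} {c u v w : ℤ}

theorem nonneg_and_le_of_nonpos (hθ0 : 0 < θ) (hθ1 : θ < 1) (hv : v ≤ 0) (huv : 0 ≤ v + θ * u)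
    (hvw : w + θ * v ∈ Icc 0 (1 + θ)) (hw : w ≤ c * (u + v)) : 0 ≤ w ∧ w ≤ u := by
  have hvR : (v : ℝ) ≤ 0 := by exact_mod_cast hv
  have hθv : θ * v ≤ 0 := mul_nonpos_of_nonneg_of_nonpos hθ0.le hvR
  have hwR : (0 : ℝ) ≤ w := by linarith [hvw.1]
  have hu : 0 ≤ u := by
    have : (0 : ℝ) ≤ u := nonneg_of_mul_nonneg_right (by linarith) hθ0
    exact_mod_cast this
  refine ⟨by exact_mod_cast hwR, ?_⟩
  have hw_le : w ≤ 1 - v := by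
    have : (w : ℝ) < 2 - v := by nlinarith [hvw.2]
    have : w < 2 - v := by exact_mod_cast this
    lia
  rcases hu.eq_or_lt with rfl | hu
  · obtain rfl : v = 0 := hv.antisymm (by exact_mod_cast (by simpa using huv : (0 : ℝ) ≤ v))
    simpa using hw
  · have huR : (0 : ℝ) < u := by exact_mod_cast hu
    have : -(v : ℝ) < u := by nlinarith
    have : -v < u := by exact_mod_cast this
    lia

theorem eq_or_natAbs_sub_lt (hθ0 : 0 < θ) (hθ1 : θ < 1) (huv : v + θ * u ∈ Icc 0 (1 + θ))
    (hvw : w + θ * v ∈ Icc 0 (1 + θ)) (hw : w ∈ Icc (c * (u + v) - (2 * c - 1)) (c * (u + v))) :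
    w = u ∨ (w - v).natAbs < (v - u).natAbs := by
  rcases le_or_gt v 0 with hv | hv
  · have := nonneg_and_le_of_nonpos hθ0 hθ1 hv huv.1 hvw hw.2
    lia
  -- The constraints are invariant under `b ↦ 1 - b`, the reflection `x ↦ m / (β - 1) - x`.
  · have := nonneg_and_le_of_nonpos (u := 1 - u) (v := 1 - v) (w := 1 - w) (c := c) hθ0 hθ1
      (by lia) (by push_cast; linarith [huv.2])
      (by push_cast; constructor <;> linarith [hvw.1, hvw.2]) (by linarith [hw.1])
    lia

theorem eventually_eq_of_eq_or_natAbs_sub_lt {b : ℕ → ℤ}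
    (h : ∀ n, b (n + 2) = b n ∨ (b (n + 2) - b (n + 1)).natAbs < (b (n + 1) - b n).natAbs) :
    ∀ᶠ n in atTop, b (n + 2) = b n := by
  let gap : ℕ → ℕ := fun n => (b (n + 1) - b n).natAbs
  have hgap : Antitone gap := antitone_nat_of_succ_le fun n => by
    rcases h n with h | h <;> simp only [gap, add_assoc, Nat.reduceAdd] <;> lia
  obtain ⟨N, hN⟩ := WellFoundedGT.monotone_chain_condition
    (⟨fun n => OrderDual.toDual (gap n), hgap⟩ : ℕ →o ℕᵒᵈ)
  refine eventually_atTop.2 ⟨N, fun n hn => (h n).resolve_right ?_⟩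
  have hconst : gap (n + 1) = gap n := (hN (n + 1) (hn.trans n.le_succ)).symm.trans (hN n hn)
  exact hconst.not_lt

end IntegerCoordinates

section GoldenBase

variable {k : ℕ} {β x : ℝ}

theorem mem_adjoin_iff (h : β ^ 2 = (k + 1) * (β + 1)) :
    x ∈ Algebra.adjoin ℤ {β} ↔ ∃ p q : ℤ, x = p * β + q := by
  constructor
  · intro hx
    induction hx using Algebra.adjoin_induction with
    | mem y hy => exact ⟨1, 0, by simpa using hy⟩
    | algebraMap r => exact ⟨0, r, by simp⟩
    | add y z _ _ hy hz =>
      obtain ⟨⟨p, q, rfl⟩, ⟨r, s, rfl⟩⟩ := And.intro hy hz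
      exact ⟨p + r, q + s, by push_cast; ring⟩
    | mul y z _ _ hy hz =>
      obtain ⟨⟨p, q, rfl⟩, ⟨r, s, rfl⟩⟩ := And.intro hy hz
      refine ⟨p * s + q * r + (k + 1) * (p * r), q * s + (k + 1) * (p * r), ?_⟩
      push_cast
      linear_combination (p * r : ℝ) * h
  · rintro ⟨p, q, rfl⟩
    exact add_mem (mul_mem (intCast_mem _ p) (Algebra.self_mem_adjoin_singleton ℤ β))
      (intCast_mem _ q)

theorem pow_mul_mem_adjoin_iff_digitRemainder {m : ℕ} (ε : ℕ → Fin (m + 1)) (x : ℝ) (n : ℕ) :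
    β ^ n * x ∈ Algebra.adjoin ℤ {β} ↔ digitRemainder β ε x n ∈ Algebra.adjoin ℤ {β} := by
  have hdiff : β ^ n * x - digitRemainder β ε x n ∈ Algebra.adjoin ℤ {β} := by
    induction n with
    | zero => simp [digitRemainder]
    | succ n ih =>
      have hsplit : β ^ (n + 1) * x - digitRemainder β ε x (n + 1) =
          β * (β ^ n * x - digitRemainder β ε x n) + (ε n : ℕ) := by
        rw [digitRemainder]
        ring
      rw [hsplit]
      exact add_mem (mul_mem (Algebra.self_mem_adjoin_singleton ℤ β) ih) (natCast_mem _ _)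
  exact ⟨fun hx => by simpa using sub_mem hx hdiff, fun hx => by simpa using add_mem hdiff hx⟩

-- Since `β ^ 2 = (k + 1) * (β + 1)` and `k + 1 = β * (β - k - 1)`, inverting `β` and inverting
-- `k + 1` produce the same fractions over `ℤ[β]`.
theorem exists_pow_mul_mem_adjoin_iff (h : β ^ 2 = (k + 1) * (β + 1)) :
    (∃ n : ℕ, β ^ n * x ∈ Algebra.adjoin ℤ {β}) ↔
      ∃ n p q : ℤ, x = (p * β + q) / ((k : ℝ) + 1) ^ n := by
  have hk : (k : ℝ) + 1 ≠ 0 := by positivity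
  have hβ := Algebra.self_mem_adjoin_singleton ℤ β
  constructor
  · rintro ⟨n, hn⟩
    have hmul : ((k : ℝ) + 1) ^ n * x = (β - (k + 1 : ℕ)) ^ n * (β ^ n * x) := by
      rw [← mul_assoc, ← mul_pow]
      congr 2
      push_cast
      linear_combination -h
    obtain ⟨p, q, hpq⟩ := (mem_adjoin_iff h).1
      (hmul ▸ mul_mem (pow_mem (sub_mem hβ (natCast_mem _ (k + 1))) n) hn)
    exact ⟨n, p, q, by rw [zpow_natCast, eq_div_iff (pow_ne_zero n hk), mul_comm, hpq]⟩
  · rintro ⟨n, p, q, rfl⟩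
    have hpq : p * β + q ∈ Algebra.adjoin ℤ {β} := (mem_adjoin_iff h).2 ⟨p, q, rfl⟩
    obtain ⟨n, rfl | rfl⟩ := n.eq_nat_or_neg
    · refine ⟨2 * n, ?_⟩
      have hmul : β ^ (2 * n) * ((p * β + q) / ((k : ℝ) + 1) ^ (n : ℤ)) =
          (β + 1) ^ n * (p * β + q) := by
        rw [pow_mul, h, mul_pow, zpow_natCast]
        field_simp
      exact hmul ▸ mul_mem (pow_mem (add_mem hβ (one_mem _)) n) hpq
    · refine ⟨0, ?_⟩
      rw [pow_zero, one_mul, zpow_neg, zpow_natCast, div_inv_eq_mul]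
      exact mul_mem hpq (pow_mem (add_mem (natCast_mem _ k) (one_mem _)) n)

theorem add_one_lt_of_sq_eq (hβ : 0 < β) (h : β ^ 2 = (k + 1) * (β + 1)) : k + 1 < β := by
  nlinarith [k.cast_nonneg (α := ℝ)]

theorem one_lt_of_sq_eq (hβ : 0 < β) (h : β ^ 2 = (k + 1) * (β + 1)) : 1 < β := by
  linarith [add_one_lt_of_sq_eq hβ h, k.cast_nonneg (α := ℝ)]

theorem div_sub_one_eq_of_sq_eq (hβ : 0 < β) (h : β ^ 2 = (k + 1) * (β + 1)) :
    (2 * k + 1 : ℕ) / (β - 1) = β - k := by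
  rw [div_eq_iff (sub_pos.2 (one_lt_of_sq_eq hβ h)).ne']
  push_cast
  linarith

/-- The integer coordinates `b` of an orbit of remainders in `ℤ[β]`: the `n`-th remainder is
`b (n + 1) + (β - k - 1) * b n`, where `-(β - k - 1)` is the algebraic conjugate of `β`. Each pair
of consecutive terms encodes one remainder, so a single sequence suffices. -/
def remainderCoord {m : ℕ} (k : ℕ) (ε : ℕ → Fin (m + 1)) (u v : ℤ) : ℕ → ℤ
  | 0 => u
  | 1 => v
  | n + 2 => (k + 1) * (remainderCoord k ε u v n + remainderCoord k ε u v (n + 1)) - (ε n : ℕ)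

theorem digitRemainder_eq_remainderCoord {m : ℕ} (h : β ^ 2 = (k + 1) * (β + 1))
    (ε : ℕ → Fin (m + 1)) (u v : ℤ) (n : ℕ) :
    digitRemainder β ε (v + (β - k - 1) * u) n =
      remainderCoord k ε u v (n + 1) + (β - k - 1) * remainderCoord k ε u v n := by
  induction n with
  | zero => rfl
  | succ n ih =>
    rw [digitRemainder, ih, remainderCoord]
    push_cast
    linear_combination (remainderCoord k ε u v n : ℝ) * h

theorem eventually_periodic_of_mem_adjoin (hβ : 0 < β) (h : β ^ 2 = (k + 1) * (β + 1))
    (hx : x ∈ Algebra.adjoin ℤ {β}) {ε : ℕ → Fin (2 * k + 1 + 1)}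
    (hε : ε ∈ betaExpansions β (2 * k + 1) x) : ∀ᶠ n in atTop, ε (n + 2) = ε n := by
  obtain ⟨u, q, hpq⟩ := (mem_adjoin_iff h).1 hx
  obtain ⟨v, rfl⟩ : ∃ v : ℤ, x = v + (β - k - 1) * u :=
    ⟨q + (k + 1) * u, by rw [hpq]; push_cast; ring⟩
  have hβ1 := one_lt_of_sq_eq hβ h
  set b := remainderCoord k ε u v
  have hb (n : ℕ) : b (n + 2) = (k + 1) * (b n + b (n + 1)) - (ε n : ℕ) := rfl
  have hmem (n : ℕ) : b (n + 1) + (β - k - 1) * b n ∈ Icc 0 (1 + (β - k - 1)) := by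
    have hrem := digitRemainder_mem_Icc hβ1 hε n
    rw [digitRemainder_eq_remainderCoord h, div_sub_one_eq_of_sq_eq hβ h] at hrem
    exact ⟨hrem.1, hrem.2.trans_eq (by ring)⟩
  have hstep (n : ℕ) : b (n + 2) ∈ Icc ((k + 1) * (b n + b (n + 1)) - (2 * (k + 1) - 1))
      ((k + 1) * (b n + b (n + 1))) := by
    have hdigit : ((ε n : ℕ) : ℤ) ≤ 2 * k + 1 := by exact_mod_cast (ε n).is_le
    rw [hb]
    constructor <;> linarith [(ε n : ℕ).cast_nonneg (α := ℤ)]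
  have hperiodic : ∀ᶠ n in atTop, b (n + 2) = b n :=
    eventually_eq_of_eq_or_natAbs_sub_lt fun n => eq_or_natAbs_sub_lt (c := k + 1)
      (by linarith [add_one_lt_of_sq_eq hβ h]) (by linarith [lt_add_two_of_sq_le hβ1 h.le])
      (hmem n) (hmem (n + 1)) (hstep n)
  filter_upwards [hperiodic, (tendsto_add_atTop_nat 1).eventually hperiodic,
    (tendsto_add_atTop_nat 2).eventually hperiodic] with n h0 h1 h2
  have hn := hb n
  have hn2 := hb (n + 2)
  rw [h2, h0, show b (n + 2 + 1) = b (n + 1) from h1] at hn2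
  exact Fin.ext (by lia)

theorem countable_betaExpansions (hβ : 0 < β) (h : β ^ 2 = (k + 1) * (β + 1)) {n : ℕ}
    (hx : β ^ n * x ∈ Algebra.adjoin ℤ {β}) : (betaExpansions β (2 * k + 1) x).Countable := by
  refine (countable_setOf_eventually_periodic two_pos).mono fun ε hε => ?_
  have htail := eventually_periodic_of_mem_adjoin hβ h
    ((pow_mul_mem_adjoin_iff_digitRemainder ε x n).1 hx)
    ((shift_mem_betaExpansions_iff hβ.ne' n).2 hε)
  rw [mem_ofPred_eq, ← map_add_atTop_eq_nat n]
  exact htail.mono fun i hi => (congrArg ε (add_right_comm i n 2)).trans hi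

theorem digitRemainder_mem_Ioo (hβ : 0 < β) (h : β ^ 2 = (k + 1) * (β + 1))
    (hx : ∀ n : ℕ, β ^ n * x ∉ Algebra.adjoin ℤ {β}) {ε : ℕ → Fin (2 * k + 1 + 1)}
    (hε : ε ∈ betaExpansions β (2 * k + 1) x) (n : ℕ) :
    digitRemainder β ε x n ∈ Ioo 0 ((2 * k + 1 : ℕ) / (β - 1)) := by
  obtain ⟨hlower, hupper⟩ := digitRemainder_mem_Icc (one_lt_of_sq_eq hβ h) hε n
  have hnot := mt (pow_mul_mem_adjoin_iff_digitRemainder ε x n).2 (hx n)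
  refine ⟨hlower.lt_of_ne fun e => hnot (e ▸ zero_mem _), hupper.lt_of_ne fun e => hnot ?_⟩
  rw [e, div_sub_one_eq_of_sq_eq hβ h]
  exact sub_mem (Algebra.self_mem_adjoin_singleton ℤ β) (natCast_mem _ k)

theorem mk_betaExpansions_eq_aleph0 (hβ : 0 < β) (h : β ^ 2 = (k + 1) * (β + 1))
    (hx : x ∈ Ioo 0 ((2 * k + 1 : ℕ) / (β - 1))) {n : ℕ}
    (hn : β ^ n * x ∈ Algebra.adjoin ℤ {β}) :
    Cardinal.mk (betaExpansions β (2 * k + 1) x) = Cardinal.aleph0 := by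
  have := (countable_betaExpansions hβ h hn).to_subtype
  have := (infinite_betaExpansions_of_mem_Ioo (one_lt_of_sq_eq hβ h) h.le hx).to_subtype
  exact Cardinal.mk_eq_aleph0 _

theorem mk_betaExpansions_eq_continuum_of_notMem_adjoin (hβ : 0 < β)
    (h : β ^ 2 = (k + 1) * (β + 1)) (hx : x ∈ Ioo 0 ((2 * k + 1 : ℕ) / (β - 1)))
    (hn : ∀ n : ℕ, β ^ n * x ∉ Algebra.adjoin ℤ {β}) :
    Cardinal.mk (betaExpansions β (2 * k + 1) x) = Cardinal.continuum :=
  have hβ1 := one_lt_of_sq_eq hβ h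
  mk_betaExpansions_eq_continuum hβ1
    (nontrivial_betaExpansions_of_mem_Ioo hβ1 h.le hx).nonempty fun _ hε n =>
      nontrivial_betaExpansions_of_mem_Ioo hβ1 h.le (digitRemainder_mem_Ioo hβ h hn hε n)

end GoldenBase

theorem generalizedGoldenRatio_odd (k : ℕ) :
    generalizedGoldenRatio (2 * k + 1) =
      ((k : ℝ) + 1 + Real.sqrt ((k : ℝ) ^ 2 + 6 * k + 5)) / 2 := by
  have hodd : ¬ Even (2 * k + 1) := by simp
  have hhalf : (2 * k + 1) / 2 = k := by lia
  simp only [generalizedGoldenRatio, if_neg hodd, hhalf]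

theorem generalizedGoldenRatio_odd_pos (k : ℕ) : 0 < generalizedGoldenRatio (2 * k + 1) := by
  rw [generalizedGoldenRatio_odd]
  positivity

theorem generalizedGoldenRatio_odd_sq (k : ℕ) :
    generalizedGoldenRatio (2 * k + 1) ^ 2 =
      (k + 1) * (generalizedGoldenRatio (2 * k + 1) + 1) := by
  rw [generalizedGoldenRatio_odd]
  linear_combination Real.sq_sqrt (show 0 ≤ (k : ℝ) ^ 2 + 6 * k + 5 by positivity) / 4

theorem mem_countableExpansionPoints_iff {k : ℕ} {x : ℝ} :
    x ∈ countableExpansionPoints k ↔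
      x ∈ Ioo 0 ((2 * k + 1 : ℕ) / (generalizedGoldenRatio (2 * k + 1) - 1)) ∧
        ∃ n : ℕ, generalizedGoldenRatio (2 * k + 1) ^ n * x ∈
          Algebra.adjoin ℤ {generalizedGoldenRatio (2 * k + 1)} :=
  and_congr_right' (exists_pow_mul_mem_adjoin_iff (generalizedGoldenRatio_odd_sq k)).symm

theorem theorem2 (k m : ℕ) (hm : m = 2 * k + 1) (β : ℝ) (hβ : β = generalizedGoldenRatio m) :
    β = ((k : ℝ) + 1 + Real.sqrt ((k : ℝ) ^ 2 + 6 * k + 5)) / 2 ∧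
    (m : ℝ) / (β - 1) = β - k ∧
    (∀ x ∈ countableExpansionPoints k,
      Cardinal.mk (betaExpansions β m x) = Cardinal.aleph0) ∧
    (∀ x ∈ Set.Ioo (0 : ℝ) (β - k), x ∉ countableExpansionPoints k →
      Cardinal.mk (betaExpansions β m x) = Cardinal.continuum) := by
  subst hm hβ
  have hpos := generalizedGoldenRatio_odd_pos k
  have hsq := generalizedGoldenRatio_odd_sq k
  have hdiv := div_sub_one_eq_of_sq_eq hpos hsq
  refine ⟨generalizedGoldenRatio_odd k, hdiv, fun x hx => ?_, fun x hx hnot => ?_⟩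
  · obtain ⟨hmem, n, hn⟩ := mem_countableExpansionPoints_iff.1 hx
    exact mk_betaExpansions_eq_aleph0 hpos hsq hmem hn
  · rw [← hdiv] at hx
    exact mk_betaExpansions_eq_continuum_of_notMem_adjoin hpos hsq hx fun n hn =>
      hnot (mem_countableExpansionPoints_iff.2 ⟨hx, n, hn⟩)
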